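/- Let $\mathbb{C}^*=\mathbb{C}\setminus\{0\}$ and let $f,g:\mathbb{C}^*\to\mathbb{C}$ be holomorphic functions. Suppose that the map $(f,e^g):\mathbb{C}^*\to\mathbb{C}\times\mathbb{C}^*$, $z\mapsto(f(z),e^{g(z)})$, is proper and injective. Then $f$ has an essential singularity at $0$ or at $\infty$ (that is, at one of these two points at least, the isolated singularity of $f$ is neither removable nor a pole). -/

import Mathlib

open Filter Topology

/-- The function `f` is holomorphic at every point of some punctured neighbourhood of `a`. -/
def HasIsolatedSingularityAt (f : ℂ → ℂ) (a : ℂ) : Prop :=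
  ∀ᶠ z in 𝓝[≠] a, DifferentiableAt ℂ f z

/-- Near `a`, away from `a` itself, `f` agrees with a function that is holomorphic at `a`. -/
def HasRemovableSingularityAt (f : ℂ → ℂ) (a : ℂ) : Prop :=
  ∃ h : ℂ → ℂ, AnalyticAt ℂ h a ∧ f =ᶠ[𝓝[≠] a] h

/-- The function `f` is holomorphic on a punctured neighbourhood of `a` and
`|f z| → ∞` as `z → a`, `z ≠ a`. -/
def HasPoleAt (f : ℂ → ℂ) (a : ℂ) : Prop :=
  HasIsolatedSingularityAt f a ∧ Tendsto (fun z => ‖f z‖) (𝓝[≠] a) atTop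

/-- An isolated singularity that is neither removable nor a pole. -/
def HasEssentialSingularityAt (f : ℂ → ℂ) (a : ℂ) : Prop :=
  HasIsolatedSingularityAt f a ∧ ¬ HasRemovableSingularityAt f a ∧ ¬ HasPoleAt f a

/-- The function `f` has an essential singularity at `∞`: in the coordinate `w = 1 / z`
of the Riemann sphere near `∞`, the function has an essential singularity at `w = 0`. -/
def HasEssentialSingularityAtInfty (f : ℂ → ℂ) : Prop :=
  HasEssentialSingularityAt (fun w => f w⁻¹) 0

/-- The punctured plane `ℂ* = ℂ \ {0}`, with the subspace topology. -/
abbrev PuncturedPlane : Type := {z : ℂ // z ≠ 0}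

/-- The map `(f, e^g) : ℂ* → ℂ × ℂ*`. Only the values of `f` and `g` on `ℂ*` enter. -/
noncomputable def pairExpMap (f g : ℂ → ℂ) : PuncturedPlane → ℂ × PuncturedPlane :=
  fun z => (f z, ⟨Complex.exp (g z), Complex.exp_ne_zero (g z)⟩)

/-! Suppose `f` has no essential singularity at either puncture. Were it bounded near one of them,
properness would force `|Re g| → ∞` there. Then `g` would have a pole, and near a pole it takes
every large value, including imaginary ones. So `f` has poles at both punctures and is proper, a
finite branched cover of the plane. Injectivity of `(f, e^g)` says that the differences of `g` at
distinct points of a fibre of `f` omit `2πiℤ`.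

Consider `fiberDiscr f g`, the product of all these differences. Being symmetric in the fibre, it is
a single-valued function of `t`, holomorphic off the finite set of critical values and bounded near
them. In the coordinate `log t` near `∞`, each factor divided by `2πi` is holomorphic and omits the
integers, so Landau's inequality bounds it by a power of `log |t|` (`isLittleO_fiberDiscr`). By
Liouville the discriminant is constant, and it is nonzero since no difference vanishes.

But `f` has a critical point: otherwise it would be a covering of the simply connected plane, hence
injective, whereas it takes all large values near both poles. Near a critical point two points of a
fibre merge, which makes the discriminant arbitrarily small: a contradiction. -/

/-! ### Lifting through local inverses, and Bloch's theorem -/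

/-- A continuous lift of a differentiable function through a local diffeomorphism is
differentiable. -/
theorem HasStrictDerivAt.differentiableAt_lift {f σ φ : ℂ → ℂ} {a f' : ℂ}
    (hf : HasStrictDerivAt f f' (σ a)) (hf' : f' ≠ 0) (hσ : ContinuousAt σ a)
    (hφ : DifferentiableAt ℂ φ a) (h : ∀ᶠ t in 𝓝 a, f (σ t) = φ t) : DifferentiableAt ℂ σ a := by
  have h1 := (hf.to_localInverse hf').hasDerivAt.differentiableAt
  rw [h.self_of_nhds] at h1
  refine (h1.comp a hφ).congr_of_eventuallyEq ?_
  filter_upwards [hσ.eventually (hf.eventually_left_inverse hf'), h] with t ht ht'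
  rw [Function.comp_apply, ← ht', ht]

open Metric in
/-- If the derivative of `F` on a ball is at most twice as large as at the centre,
then the image of the ball contains a disc of comparable size. -/
theorem exists_ball_subset_image_of_norm_deriv_le {F : ℂ → ℂ} {z : ℂ} {d L : ℝ} (hd : 0 < d)
    (hL : 0 < L) (hF : DifferentiableOn ℂ F (ball z d)) (hFz : ‖deriv F z‖ = L)
    (hb : ∀ w ∈ ball z d, ‖deriv F w‖ ≤ 2 * L) :
    ball (F z) (L * d / 24) ⊆ F '' ball z d := by
  have hsub : closedBall z (d / 6) ⊆ ball z d := closedBall_subset_ball (by linarith)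
  have hdF : DifferentiableOn ℂ (deriv F) (ball z d) := hF.deriv isOpen_ball
  -- Schwarz lemma for `deriv F`, which maps the ball into the disc of radius `L + 2L` about `deriv
  -- F z`.
  have hschwarz : ∀ w ∈ ball z d, ‖deriv F w - deriv F z‖ ≤ 3 * L / d * ‖w - z‖ := by
    intro w hw
    have := Complex.dist_le_div_mul_dist_of_mapsTo_ball (R₂ := 3 * L) hdF (fun v hv => ?_) hw
    · simpa [dist_eq_norm] using this
    · rw [mem_closedBall, dist_eq_norm]
      linarith [norm_sub_le (deriv F v) (deriv F z), hb v hv]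
  -- On radius `d / 6` the derivative varies by at most `L / 2`, so `F` differs from its linear part
  -- by at most half the size `L * d / 6` of that part.
  have hmain : ∀ w ∈ sphere z (d / 6), L * d / 12 ≤ ‖F w - F z‖ := by
    intro w hw
    have hwz : ‖w - z‖ = d / 6 := by simpa [dist_eq_norm] using hw
    have key := (convex_closedBall z (d / 6)).norm_image_sub_le_of_norm_hasDerivWithin_le
      (f := fun v => F v - deriv F z * v) (f' := fun v => deriv F v - deriv F z) (C := L / 2)
      (x := z) (y := w) (fun v hv => ?_) (fun v hv => ?_) (mem_closedBall_self (by linarith))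
      (sphere_subset_closedBall hw)
    · have e : F w - F z = (F w - deriv F z * w - (F z - deriv F z * z)) + deriv F z * (w - z) := by
        ring
      have h2 := norm_sub_le_norm_add (deriv F z * (w - z))
        (F w - deriv F z * w - (F z - deriv F z * z))
      rw [add_comm, ← e, norm_mul, hFz, hwz] at h2
      rw [hwz] at key
      linarith
    · have := (hF.differentiableAt (isOpen_ball.mem_nhds (hsub hv))).hasDerivAt
      simpa [Pi.sub_def] using
        (this.sub ((hasDerivAt_id v).const_mul (deriv F z))).hasDerivWithinAt
    · refine (hschwarz v (hsub hv)).trans ?_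
      have : ‖v - z‖ ≤ d / 6 := by simpa [dist_eq_norm] using hv
      calc 3 * L / d * ‖v - z‖ ≤ 3 * L / d * (d / 6) := by gcongr
        _ = L / 2 := by field_simp; norm_num
  have hfreq : ∃ᶠ w in 𝓝 z, F w ≠ F z := by
    intro h
    have h' : F =ᶠ[𝓝 z] fun _ => F z := by
      filter_upwards [h] with w hw using not_not.1 hw
    have := h'.deriv_eq
    simp [this] at hFz
    linarith
  have h := DiffContOnCl.ball_subset_image_closedBall (f := F) (z₀ := z) (r := d / 6)
    (hF.mono hsub |>.diffContOnCl_ball subset_rfl) (by linarith) hmain hfreq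
  have e : L * d / 12 / 2 = L * d / 24 := by ring
  rw [e] at h
  exact h.trans (Set.image_mono hsub)

open Metric in
/-- **Bloch's theorem**. -/
theorem exists_ball_subset_image_ball {F : ℂ → ℂ} {a : ℂ} {r : ℝ}
    (hF : DifferentiableOn ℂ F (ball a r)) (hr : 0 < r) (hFa : deriv F a ≠ 0) :
    ∃ w, ball w (r * ‖deriv F a‖ / 96) ⊆ F '' ball a r := by
  set ρ := r / 2 with hρ
  have hsub : closedBall a ρ ⊆ ball a r := closedBall_subset_ball (by linarith)
  have hdF : DifferentiableOn ℂ (deriv F) (ball a r) := hF.deriv isOpen_ball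
  -- At a maximum `z` of this weighted derivative, the weight on the disc of radius `d`, half its
  -- value at `z`, is still at least `d`; hence `‖deriv F‖ ≤ 2 * ‖deriv F z‖` there.
  obtain ⟨z, hz, hmax⟩ := (isCompact_closedBall a ρ).exists_isMaxOn
    ⟨a, mem_closedBall_self (by linarith)⟩
    (f := fun w => (ρ - ‖w - a‖) * ‖deriv F w‖)
    (by
      have := hdF.continuousOn.mono hsub
      fun_prop)
  have hpos : 0 < ‖deriv F a‖ := norm_pos_iff.2 hFa
  have h1 : ρ * ‖deriv F a‖ ≤ (ρ - ‖z - a‖) * ‖deriv F z‖ := by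
    simpa using hmax (mem_closedBall_self (by linarith : 0 ≤ ρ))
  have hzρ : ‖z - a‖ ≤ ρ := by simpa [dist_eq_norm] using hz
  have h2 : 0 < (ρ - ‖z - a‖) * ‖deriv F z‖ := lt_of_lt_of_le (by positivity) h1
  have h3 : 0 < ρ - ‖z - a‖ := pos_of_mul_pos_left h2 (norm_nonneg _)
  have h4 : 0 < ‖deriv F z‖ := pos_of_mul_pos_right h2 h3.le
  set d := (ρ - ‖z - a‖) / 2 with hd
  have hd0 : 0 < d := by linarith
  have hball : ∀ w ∈ ball z d, ‖w - a‖ ≤ ρ - d := by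
    intro w hw
    have : ‖w - z‖ < d := by simpa [dist_eq_norm] using hw
    have := norm_sub_le_norm_sub_add_norm_sub w z a
    linarith
  have hsub2 : ball z d ⊆ closedBall a ρ := fun w hw => by
    have := hball w hw
    rw [mem_closedBall, dist_eq_norm]; linarith
  refine ⟨F z, ?_⟩
  have h := exists_ball_subset_image_of_norm_deriv_le hd0 h4 (hF.mono (hsub2.trans hsub)) rfl
    (fun w hw => ?_)
  · refine (ball_subset_ball ?_).trans (h.trans (Set.image_mono (hsub2.trans hsub)))
    have e : (ρ - ‖z - a‖) * ‖deriv F z‖ = 2 * d * ‖deriv F z‖ := by rw [hd]; ring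
    have : ρ * ‖deriv F a‖ = r * ‖deriv F a‖ / 2 := by rw [hρ]; ring
    linarith
  · have h5 := hmax (hsub2 hw)
    simp only [Set.mem_ofPred_eq] at h5
    have h6 : d * ‖deriv F w‖ ≤ (ρ - ‖w - a‖) * ‖deriv F w‖ := by
      gcongr; linarith [hball w hw]
    have h7 : d * ‖deriv F w‖ ≤ d * (2 * ‖deriv F z‖) := by
      refine (h6.trans h5).trans_eq ?_
      rw [hd]; ring
    exact le_of_mul_le_mul_left h7 hd0

/-! ### Landau's inequality and growth of functions omitting the integers -/

open Metric in
/-- A zero-free holomorphic function on a ball has a holomorphic logarithm. -/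
theorem DifferentiableOn.exists_exp_eq_on_ball {F : ℂ → ℂ} {a : ℂ} {r : ℝ} (hr : 0 < r)
    (hF : DifferentiableOn ℂ F (ball a r)) (h0 : ∀ z ∈ ball a r, F z ≠ 0) :
    ∃ L : ℂ → ℂ, DifferentiableOn ℂ L (ball a r) ∧ ∀ z ∈ ball a r, Complex.exp (L z) = F z := by
  have hsc : IsSimplyConnected (ball a r) := by
    have := (convex_ball a r).contractibleSpace (nonempty_ball.2 hr)
    exact (inferInstance : SimplyConnectedSpace (ball a r))
  obtain ⟨L, hLc, hL⟩ := Complex.exists_continuousOn_eqOn_exp_comp hsc isOpen_ball hF.continuousOn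
    (by rintro ⟨z, hz, h⟩; exact h0 z hz h)
  refine ⟨L, fun z hz => ?_, hL⟩
  have hnh := isOpen_ball.mem_nhds hz
  exact ((Complex.hasStrictDerivAt_exp (L z)).differentiableAt_lift (Complex.exp_ne_zero _)
    (hLc.continuousAt hnh) (hF.differentiableAt hnh)
    (eventually_of_mem hnh fun t ht => hL ht)).differentiableWithinAt

/-- Every disc of radius `6` contains a point where `cosh` is an integer. -/
theorem exists_cosh_eq_intCast (w : ℂ) : ∃ v ∈ Metric.ball w 6, ∃ n : ℤ, Complex.cosh v = n := by
  obtain ⟨k, hk⟩ : ∃ k : ℤ, |w.im - k * Real.pi| ≤ Real.pi := by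
    refine ⟨⌊w.im / Real.pi⌋, ?_⟩
    have h1 := Int.floor_le (w.im / Real.pi)
    have h2 := Int.lt_floor_add_one (w.im / Real.pi)
    rw [le_div_iff₀ Real.pi_pos] at h1
    rw [div_lt_iff₀ Real.pi_pos] at h2
    rw [abs_le]; constructor <;> nlinarith [Real.pi_pos]
  -- On `[x, x + 2]` the real `cosh` grows by at least `1`, so it passes through an integer.
  have hpos : ∀ x : ℝ, 0 ≤ x → ∃ y, |y - x| ≤ 2 ∧ ∃ n : ℤ, Real.cosh y = n := by
    intro x hx
    have hgrow : Real.cosh x + 1 ≤ Real.cosh (x + 2) := by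
      have h2 : 2 ≤ Real.cosh 2 := by
        have h := Real.add_one_le_exp (2 : ℝ)
        have h' : Real.exp 2 = Real.exp 1 * Real.exp 1 := by rw [← Real.exp_add]; norm_num
        rw [Real.cosh_eq]
        nlinarith [Real.exp_pos (-2), Real.exp_one_gt_d9]
      rw [Real.cosh_add]
      nlinarith [Real.one_le_cosh x, mul_nonneg (Real.sinh_nonneg_iff.2 hx)
        (Real.sinh_nonneg_iff.2 (by norm_num : (0 : ℝ) ≤ 2))]
    obtain ⟨y, hy, hyn⟩ := intermediate_value_Icc (by linarith : x ≤ x + 2)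
      Real.continuous_cosh.continuousOn (show (⌈Real.cosh x⌉ : ℝ) ∈ _ from
        ⟨Int.le_ceil _, by linarith [Int.ceil_lt_add_one (Real.cosh x)]⟩)
    exact ⟨y, abs_le.2 ⟨by linarith [hy.1], by linarith [hy.2]⟩, _, hyn⟩
  obtain ⟨y, hy, n, hn⟩ : ∃ y, |y - w.re| ≤ 2 ∧ ∃ n : ℤ, Real.cosh y = n := by
    rcases le_total 0 w.re with h | h
    · exact hpos _ h
    · obtain ⟨y, hy, n, hn⟩ := hpos (-w.re) (by linarith)
      refine ⟨-y, ?_, n, by simpa using hn⟩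
      rw [← abs_neg]; convert hy using 2; ring
  -- `cosh (y + kπi) = (-1)^k cosh y`; the distance to `w` is at most `2 + π < 6`.
  refine ⟨y + (k * Real.pi : ℝ) * Complex.I, ?_, Int.negOnePow k * n, ?_⟩
  · rw [Metric.mem_ball, dist_eq_norm]
    refine (Complex.norm_le_abs_re_add_abs_im _).trans_lt ?_
    have : |(y + (k * Real.pi : ℝ) * Complex.I - w).im| ≤ Real.pi := by
      rw [← abs_neg]
      convert hk using 2
      simp
    have h' : |(y + (k * Real.pi : ℝ) * Complex.I - w).re| ≤ 2 := by
      simpa using hy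
    linarith [Real.pi_lt_four]
  · rw [Complex.cosh_add, Complex.cosh_mul_I, Complex.sinh_mul_I]
    have h1 : Complex.sin ((k * Real.pi : ℝ) : ℂ) = 0 := by
      rw [← Complex.ofReal_sin, Real.sin_int_mul_pi]; simp
    have h2 : Complex.cos ((k * Real.pi : ℝ) : ℂ) = ((Int.negOnePow k : ℤ) : ℂ) := by
      rw [← Complex.ofReal_cos, Real.cos_int_mul_pi, Int.cast_negOnePow]
      push_cast; rfl
    rw [h1, h2, ← Complex.ofReal_cosh, hn]
    push_cast; ring

open Metric in
/-- **Landau's inequality** for holomorphic functions omitting the integers. -/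
theorem norm_deriv_le_of_forall_ne_intCast {F : ℂ → ℂ} {a : ℂ} {r : ℝ} (hr : 0 < r)
    (hF : DifferentiableOn ℂ F (ball a r)) (hZ : ∀ z ∈ ball a r, ∀ n : ℤ, F z ≠ n) :
    ‖deriv F a‖ ≤ 576 / r * (1 + ‖F a‖) := by
  have ha := mem_ball_self (x := a) hr
  -- As `F` omits `±1`, `exp (l / 2)` is a square root of `F ^ 2 - 1`; a logarithm `G` of `F + exp
  -- (l / 2)` then satisfies `cosh G = F`.
  obtain ⟨l, hld, hl⟩ := DifferentiableOn.exists_exp_eq_on_ball (F := fun z => F z ^ 2 - 1) hr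
    ((hF.pow 2).sub_const 1) (fun z hz h => by
      have : (F z - 1) * (F z + 1) = 0 := by linear_combination h
      rcases mul_eq_zero.1 this with h | h
      · exact hZ z hz 1 (by push_cast; linear_combination h)
      · exact hZ z hz (-1) (by push_cast; linear_combination h))
  have hq : ∀ z ∈ ball a r, Complex.exp (l z / 2) ^ 2 = F z ^ 2 - 1 := fun z hz => by
    rw [← hl z hz, ← Complex.exp_nat_mul]; congr 1; push_cast; ring
  have hprod : ∀ z ∈ ball a r, (F z + Complex.exp (l z / 2)) * (F z - Complex.exp (l z / 2)) = 1 :=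
    fun z hz => by linear_combination -(hq z hz)
  obtain ⟨G, hGd, hG⟩ := DifferentiableOn.exists_exp_eq_on_ball
    (F := fun z => F z + Complex.exp (l z / 2)) hr
    (hF.add (hld.div_const 2).cexp) (fun z hz h => by simpa [h] using hprod z hz)
  have hG' : ∀ z ∈ ball a r, Complex.exp (-G z) = F z - Complex.exp (l z / 2) := fun z hz => by
    rw [Complex.exp_neg, hG z hz]
    exact inv_eq_of_mul_eq_one_right (hprod z hz)
  have hcosh : ∀ z ∈ ball a r, Complex.cosh (G z) = F z := fun z hz => by
    rw [Complex.cosh, hG z hz, hG' z hz]; ring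
  -- `G` omits every point where `cosh` is an integer, so its image contains no disc of radius `6`.
  -- Bloch's theorem gives the constant `576 = 6 * 96`.
  have hGa : ‖deriv G a‖ ≤ 576 / r := by
    by_cases h0 : deriv G a = 0
    · rw [h0, norm_zero]; positivity
    obtain ⟨w, hw⟩ := exists_ball_subset_image_ball hGd hr h0
    by_contra! hlt
    obtain ⟨v, hv, n, hn⟩ := exists_cosh_eq_intCast w
    rw [div_lt_iff₀ hr] at hlt
    obtain ⟨z, hz, rfl⟩ := hw (ball_subset_ball (by linarith) hv)
    exact hZ z hz n (by rw [← hcosh z hz, hn])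
  have hnh := isOpen_ball.mem_nhds ha
  have hderiv : deriv F a = Complex.sinh (G a) * deriv G a := by
    have h1 := (hGd.differentiableAt hnh).hasDerivAt.ccosh
    rw [← h1.deriv]
    exact EventuallyEq.deriv_eq (eventually_of_mem hnh fun z hz => (hcosh z hz).symm)
  have hsinh : ‖Complex.sinh (G a)‖ ≤ 1 + ‖F a‖ := by
    refine le_of_sq_le_sq ?_ (by positivity)
    rw [← norm_pow, Complex.sinh_sq, hcosh a ha]
    refine (norm_sub_le _ _).trans ?_
    rw [norm_pow, norm_one]
    nlinarith [norm_nonneg (F a)]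
  rw [hderiv, norm_mul, mul_comm]
  gcongr

/-- A holomorphic function on a right half-plane that omits the integers grows at most
polynomially in horizontal half-strips. -/
theorem exists_norm_le_pow_of_forall_ne_intCast {F : ℂ → ℂ} {R : ℝ}
    (hF : DifferentiableOn ℂ F {z | R < z.re}) (hZ : ∀ z : ℂ, R < z.re → ∀ n : ℤ, F z ≠ n) :
    ∃ (C : ℝ) (k : ℕ), ∀ z : ℂ, R + 1 ≤ z.re → |z.im| ≤ Real.pi → ‖F z‖ ≤ C * (z.re - R) ^ k := by
  have hopen : IsOpen {z : ℂ | R < z.re} := isOpen_lt continuous_const Complex.continuous_re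
  have hderiv : ∀ z : ℂ, R < z.re → ‖deriv F z‖ ≤ 576 / (z.re - R) * (1 + ‖F z‖) := by
    intro z hz
    have hsub : ∀ w ∈ Metric.ball z (z.re - R), R < w.re := fun w hw => by
      have h1 := Complex.abs_re_le_norm (w - z)
      rw [Metric.mem_ball, dist_eq_norm] at hw
      rw [Complex.sub_re] at h1
      linarith [neg_abs_le (w.re - z.re)]
    exact norm_deriv_le_of_forall_ne_intCast (by linarith) (hF.mono hsub)
      fun w hw => hZ w (hsub w hw)
  obtain ⟨M, hM⟩ := (isCompact_Icc (a := -Real.pi) (b := Real.pi)).exists_bound_of_continuousOn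
    (f := fun y : ℝ => F (↑(R + 1) + y * Complex.I)) (by
      refine hF.continuousOn.comp (by fun_prop) fun y _ => ?_
      simp)
  refine ⟨M + 1, 576, fun z hz hzi => ?_⟩
  -- With `τ = log (Re z - R)` as variable, Landau's inequality becomes `‖u'‖ ≤ 576 * (1 + ‖u‖)`,
  -- and Grönwall's exponential in `τ` is a power of `Re z - R`.
  set u : ℝ → ℂ := fun τ => F (R + Real.exp τ + z.im * Complex.I) with hu
  have hmem : ∀ τ : ℝ, R < ((R : ℂ) + Real.exp τ + z.im * Complex.I).re := fun τ => by
    simp [Real.exp_pos, -Complex.ofReal_exp]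
  have hu' : ∀ τ : ℝ, HasDerivAt u
      (deriv F (R + Real.exp τ + z.im * Complex.I) * Real.exp τ) τ := fun τ => by
    have h1 := (hF.differentiableAt (hopen.mem_nhds (hmem τ))).hasDerivAt
    refine h1.comp τ ?_
    simpa using (((Real.hasDerivAt_exp τ).ofReal_comp).const_add (R : ℂ)).add_const
      (z.im * Complex.I)
  have hpos : 0 < z.re - R := by linarith
  have hlog : 0 ≤ Real.log (z.re - R) := Real.log_nonneg (by linarith)
  have key := norm_le_gronwallBound_of_norm_deriv_right_le (f := u) (δ := M) (K := 576) (ε := 576)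
    (a := 0) (b := Real.log (z.re - R)) (fun τ _ => (hu' τ).continuousAt.continuousWithinAt)
    (fun τ _ => (hu' τ).hasDerivWithinAt) ?_ (fun τ _ => ?_) _ (Set.right_mem_Icc.2 hlog)
  · rw [gronwallBound_of_K_ne_0 (by norm_num), sub_zero] at key
    have he : Real.exp (576 * Real.log (z.re - R)) = (z.re - R) ^ 576 := by
      rw [← Real.exp_log hpos, ← Real.exp_nat_mul, Real.log_exp]; norm_num
    have hz' : u (Real.log (z.re - R)) = F z := by
      rw [hu]; simp only; rw [Real.exp_log hpos]
      congr 1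
      apply Complex.ext <;> simp
    simp only [he, hz'] at key
    refine key.trans ?_
    rw [div_self (by norm_num)]
    generalize (z.re - R) ^ 576 = P
    linarith
  · have := hM z.im (abs_le.1 hzi)
    simpa [hu] using this
  · have h1 := hderiv _ (hmem τ)
    have h2 : ((R : ℂ) + Real.exp τ + z.im * Complex.I).re - R = Real.exp τ := by
      simp [-Complex.ofReal_exp]
    rw [h2] at h1
    rw [norm_mul, Complex.norm_real, Real.norm_of_nonneg (Real.exp_pos τ).le]
    refine (mul_le_mul_of_nonneg_right h1 (Real.exp_pos τ).le).trans_eq ?_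
    have := (Real.exp_pos τ).ne'
    rw [hu]; field_simp; ring

/-! ### Poles and critical points -/

/-- The reciprocal of a function with a pole extends analytically by `0`. -/
theorem HasPoleAt.exists_analyticAt_inv {f : ℂ → ℂ} {a : ℂ} (h : HasPoleAt f a) :
    ∃ k : ℂ → ℂ, AnalyticAt ℂ k a ∧ k a = 0 ∧ ∀ᶠ z in 𝓝[≠] a, f z ≠ 0 ∧ k z = (f z)⁻¹ := by
  have hne : ∀ᶠ z in 𝓝[≠] a, f z ≠ 0 := by
    filter_upwards [h.2.eventually_gt_atTop 0] with z hz using norm_pos_iff.1 hz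
  have hne' : ∀ᶠ z in 𝓝[≠] a, z ≠ a := eventually_mem_nhdsWithin
  have hlim : Tendsto (fun z => (f z)⁻¹) (𝓝[≠] a) (𝓝 0) :=
    tendsto_zero_iff_norm_tendsto_zero.2 (by simp only [norm_inv]; exact h.2.inv_tendsto_atTop)
  have hk : ∀ᶠ z in 𝓝[≠] a, Function.update (fun z => (f z)⁻¹) a 0 z = (f z)⁻¹ := by
    filter_upwards [hne'] with z hz using Function.update_of_ne hz _ _
  refine ⟨Function.update (fun z => (f z)⁻¹) a 0, ?_, by simp, hne.and hk⟩
  refine Complex.analyticAt_of_differentiable_on_punctured_nhds_of_continuousAt ?_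
    (continuousAt_update_same.2 hlim)
  filter_upwards [hne', h.1, hne] with z hz hd h0
  refine (hd.inv h0).congr_of_eventuallyEq ?_
  filter_upwards [isOpen_ne.mem_nhds hz] with w hw using Function.update_of_ne hw _ _

/-- A nonconstant analytic function has isolated critical points. -/
theorem AnalyticAt.eventually_deriv_ne_zero {f : ℂ → ℂ} {a : ℂ} (hf : AnalyticAt ℂ f a)
    (hnc : ¬ ∀ᶠ z in 𝓝 a, f z = f a) : ∀ᶠ z in 𝓝[≠] a, deriv f z ≠ 0 := by
  refine hf.deriv.eventually_eq_zero_or_eventually_ne_zero.resolve_left fun h0 => hnc ?_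
  obtain ⟨r, hr, hball⟩ := Metric.eventually_nhds_iff_ball.1 (h0.and hf.eventually_analyticAt)
  filter_upwards [Metric.ball_mem_nhds a hr] with z hz
  exact Metric.isOpen_ball.is_const_of_deriv_eq_zero (convex_ball a r).isPreconnected
    (fun w hw => (hball w hw).2.differentiableAt.differentiableWithinAt)
    (fun w hw => (hball w hw).1) hz (Metric.mem_ball_self hr)

/-- Near a pole, a function has no critical points. -/
theorem HasPoleAt.eventually_deriv_ne_zero {f : ℂ → ℂ} {a : ℂ} (h : HasPoleAt f a) :
    ∀ᶠ z in 𝓝[≠] a, deriv f z ≠ 0 := by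
  obtain ⟨k, hk, hka, hkf⟩ := h.exists_analyticAt_inv
  have hk0 : ¬ ∀ᶠ z in 𝓝 a, k z = k a := fun h0 => by
    obtain ⟨z, hz, h1, h2⟩ := ((h0.filter_mono nhdsWithin_le_nhds).and hkf).exists
    rw [hka, h2] at hz
    exact inv_ne_zero h1 hz
  have hdk := hk.eventually_deriv_ne_zero hk0
  have hkf' : ∀ᶠ z in 𝓝[≠] a, ∀ᶠ w in 𝓝 z, k w = (f w)⁻¹ :=
    (eventually_eventually_nhdsWithin.2 hkf).mp <| by
      filter_upwards [eventually_mem_nhdsWithin] with z hz h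
      rw [isOpen_compl_singleton.nhdsWithin_eq hz] at h
      exact h.mono fun w hw => hw.2
  filter_upwards [hdk, hkf, hkf', h.1] with z h1 h2 h3 h4 h5
  refine h1 ?_
  rw [EventuallyEq.deriv_eq h3, deriv_fun_inv'' h4 h2.1, h5]
  simp

/-- In every punctured neighbourhood of a pole, a function takes all large values. -/
theorem HasPoleAt.cobounded_le_map {f : ℂ → ℂ} {a : ℂ} (h : HasPoleAt f a) :
    Bornology.cobounded ℂ ≤ map f (𝓝[≠] a) := by
  obtain ⟨k, hk, hka, hkf⟩ := h.exists_analyticAt_inv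
  have hk0 : ¬ ∀ᶠ z in 𝓝 a, k z = k a := fun h0 => by
    obtain ⟨z, hz, h1, h2⟩ := ((h0.filter_mono nhdsWithin_le_nhds).and hkf).exists
    rw [hka, h2] at hz
    exact inv_ne_zero h1 hz
  have hopen := hk.eventually_constant_or_nhds_le_map_nhds.resolve_left hk0
  rw [hka] at hopen
  intro V hV
  have hV' : insert a {z | f z ∈ V ∧ k z = (f z)⁻¹} ∈ 𝓝 a := by
    refine insert_mem_nhds_iff.2 ?_
    filter_upwards [hV, hkf] with z h1 h2 using ⟨h1, h2.2⟩
  have hev : ∀ᶠ v in 𝓝 (0 : ℂ), v ∈ k '' insert a {z | f z ∈ V ∧ k z = (f z)⁻¹} :=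
    hopen (image_mem_map hV')
  have hinv := (tendsto_inv₀_cobounded (α := ℂ)).eventually hev
  filter_upwards [hinv, Bornology.eventually_ne_cobounded (0 : ℂ)] with t ht ht0
  obtain ⟨z, rfl | hz, hzt⟩ := ht
  · rw [hka] at hzt
    exact absurd hzt.symm (inv_ne_zero ht0)
  · rw [hz.2, inv_inj] at hzt
    exact hzt ▸ hz.1

/-- An injective holomorphic function has no critical points. -/
theorem deriv_ne_zero_of_injOn {f : ℂ → ℂ} {U : Set ℂ} {a : ℂ} (hU : U ∈ 𝓝 a)
    (hf : AnalyticAt ℂ f a) (hinj : Set.InjOn f U) : deriv f a ≠ 0 := by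
  intro ha
  have hnc : ¬ ∀ᶠ z in 𝓝 a, f z = f a := fun h => by
    obtain ⟨z, ⟨hz, hzU⟩, hza⟩ := (((h.and hU).filter_mono nhdsWithin_le_nhds).and
      (eventually_mem_nhdsWithin (a := a) (s := {a}ᶜ))).exists
    exact hza (hinj hzU (mem_of_mem_nhds hU) hz)
  have hd0 := hf.eventually_deriv_ne_zero hnc
  obtain ⟨r, hr, hball⟩ := Metric.eventually_nhds_iff_ball.1
    ((eventually_nhdsWithin_iff.1 hd0).and (hf.eventually_analyticAt.and hU))
  set V := Metric.ball a r
  have hVo : IsOpen V := Metric.isOpen_ball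
  have haV : a ∈ V := Metric.mem_ball_self hr
  have hinjV : Set.InjOn f V := hinj.mono fun z hz => (hball z hz).2.2
  have hopen := hf.eventually_constant_or_nhds_le_map_nhds.resolve_left hnc
  -- The local inverse `h` is continuous at `f a` by the open mapping theorem and holomorphic nearby
  -- off `f a`, hence analytic at `f a`; the chain rule for `h ∘ f = id` then excludes `deriv f a =
  -- 0`.
  set h : ℂ → ℂ := Function.invFunOn f V
  have hleft : ∀ z ∈ V, h (f z) = z := fun z hz => hinjV.leftInvOn_invFunOn hz
  have himg : f '' V ∈ 𝓝 (f a) := hopen (image_mem_map (hVo.mem_nhds haV))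
  have hcont : ContinuousAt h (f a) := by
    rw [ContinuousAt, hleft a haV]
    intro W hW
    rw [mem_map]
    have hWV : f '' (W ∩ V) ∈ 𝓝 (f a) :=
      hopen (image_mem_map (inter_mem hW (hVo.mem_nhds haV)))
    filter_upwards [hWV] with t ht
    obtain ⟨z, ⟨hzW, hzV⟩, rfl⟩ := ht
    rw [Set.mem_preimage, hleft z hzV]
    exact hzW
  have hdiff : ∀ᶠ t in 𝓝[≠] (f a), DifferentiableAt ℂ h t := by
    filter_upwards [nhdsWithin_le_nhds himg, eventually_mem_nhdsWithin] with t ht hta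
    obtain ⟨z, hz, rfl⟩ := ht
    have hza : z ≠ a := fun h => hta (by rw [h]; rfl)
    exact ((hball z hz).2.1.hasStrictDerivAt.to_local_left_inverse ((hball z hz).1 hza)
      (eventually_of_mem (hVo.mem_nhds hz) hleft)).hasDerivAt.differentiableAt
  have hh := (Complex.analyticAt_of_differentiable_on_punctured_nhds_of_continuousAt hdiff
    hcont).differentiableAt.hasDerivAt
  have h1 := hh.comp a hf.differentiableAt.hasDerivAt
  have h2 : HasDerivAt (h ∘ f) 1 a :=
    (hasDerivAt_id a).congr_of_eventuallyEq (eventually_of_mem (hVo.mem_nhds haV) hleft)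
  have := h1.unique h2
  rw [ha, mul_zero] at this
  exact zero_ne_one this

/-! ### Proper maps from the punctured plane: fibres, coverings, sections -/

theorem isOpen_punctured : IsOpen {z : ℂ | z ≠ 0} := isOpen_ne

/-- The points of the punctured plane that `f` maps to `t`. -/
def puncturedFiber (f : ℂ → ℂ) (t : ℂ) : Set ℂ := {z | z ≠ 0 ∧ f z = t}

/-- A function on the punctured plane is a local homeomorphism away from its critical points. -/
theorem isLocalHomeomorphOn_of_deriv_ne_zero {f : ℂ → ℂ}
    (hf : DifferentiableOn ℂ f {z | z ≠ 0}) {s : Set PuncturedPlane}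
    (hs : ∀ z ∈ s, deriv f z ≠ 0) : IsLocalHomeomorphOn (fun z : PuncturedPlane => f z) s := by
  intro z hz
  have hnh := isOpen_punctured.mem_nhds z.2
  have hst := (hf.analyticAt hnh).hasStrictDerivAt.hasStrictFDerivAt_equiv (hs z hz)
  have hemb : IsOpenEmbedding ((↑) : PuncturedPlane → ℂ) := isOpen_punctured.isOpenEmbedding_subtypeVal
  have : Nonempty PuncturedPlane := ⟨z⟩
  refine ⟨(hemb.toOpenPartialHomeomorph _).trans (hst.toOpenPartialHomeomorph f), ?_, ?_⟩
  · simpa using hst.mem_toOpenPartialHomeomorph_source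
  · ext w; simp

/-- The fibre is compact by properness and discrete because `f` is a local homeomorphism at its
points. -/
theorem finite_puncturedFiber {f : ℂ → ℂ} (hf : DifferentiableOn ℂ f {z | z ≠ 0})
    (hp : IsProperMap (fun z : PuncturedPlane => f z)) {t : ℂ}
    (ht : ∀ z ∈ puncturedFiber f t, deriv f z ≠ 0) : (puncturedFiber f t).Finite := by
  have hloc := isLocalHomeomorphOn_of_deriv_ne_zero hf
    (s := (fun z : PuncturedPlane => f z) ⁻¹' {t}) fun z hz => ht _ ⟨z.2, hz⟩
  have hfin := (hp.isCompact_preimage (isCompact_singleton (x := t))).finite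
    (IsDiscrete.of_openPartialHomeomorph _ subset_rfl fun e he => by
      obtain ⟨φ, h1, h2⟩ := hloc e he
      exact ⟨φ, h1, h2.symm⟩)
  refine (hfin.image Subtype.val).subset fun z hz => ⟨⟨z, hz.1⟩, hz.2, rfl⟩

/-- A closed local homeomorphism with finite fibres is a covering. -/
theorem isCoveringMapOn_of_isProperMap {f : ℂ → ℂ} (hf : DifferentiableOn ℂ f {z | z ≠ 0})
    (hp : IsProperMap (fun z : PuncturedPlane => f z)) {s : Set ℂ}
    (hs : ∀ t ∈ s, ∀ z ∈ puncturedFiber f t, deriv f z ≠ 0) :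
    IsCoveringMapOn (fun z : PuncturedPlane => f z) s := by
  have hloc := isLocalHomeomorphOn_of_deriv_ne_zero hf
    (s := (fun z : PuncturedPlane => f z) ⁻¹' s) fun z hz => hs _ hz _ ⟨z.2, rfl⟩
  refine hp.isClosedMap.isCoveringMapOn_of_isLocalHomeomorphOn (fun t ht => ?_) hloc
  refine ((finite_puncturedFiber hf hp (hs t ht)).preimage Subtype.val_injective.injOn).subset ?_
  exact fun z hz => ⟨z.2, hz⟩

/-- Holomorphic sections of a proper map over a convex set of parameters with regular values:
the family `σ e s`, indexed by the fibre over `φ a`, enumerates the fibre over `φ s`. -/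
theorem exists_sections_of_isProperMap {f : ℂ → ℂ} (hf : DifferentiableOn ℂ f {z | z ≠ 0})
    (hp : IsProperMap (fun z : PuncturedPlane => f z)) {S : Set ℂ} (hSc : Convex ℝ S)
    (hSo : IsOpen S) {φ : ℂ → ℂ} (hφ : DifferentiableOn ℂ φ S)
    (hreg : ∀ s ∈ S, ∀ z ∈ puncturedFiber f (φ s), deriv f z ≠ 0) {a : ℂ} (ha : a ∈ S) :
    ∃ σ : ℂ → ℂ → ℂ, (∀ e ∈ puncturedFiber f (φ a), DifferentiableOn ℂ (σ e) S) ∧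
      ∀ s ∈ S, Set.BijOn (fun e => σ e s) (puncturedFiber f (φ a)) (puncturedFiber f (φ s)) := by
  classical
  have hcov := isCoveringMapOn_of_isProperMap hf hp (s := φ '' S) (by
    rintro _ ⟨s, hs, rfl⟩; exact hreg s hs)
  have : ContractibleSpace S := hSc.contractibleSpace ⟨a, ha⟩
  have : LocallyPathConnectedSpace S := hSo.locallyPathConnectedSpace
  let Φ : C(S, ℂ) := ⟨fun s => φ s, hφ.continuousOn.domRestrict⟩
  -- `S` is contractible and locally path connected, so lifts exist and are determined by one value.
  -- Uniqueness makes the enumeration of fibres injective; lifting back from `s` to `a` makes it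
  -- surjective.
  have hlift : ∀ (s : S) (e : PuncturedPlane), f e = φ s →
      ∃! F : C(S, PuncturedPlane), F s = e ∧ (fun z : PuncturedPlane => f z) ∘ F = Φ :=
    fun s e he => hcov.existsUnique_continuousMap_lifts Φ he fun s' => ⟨s', s'.2, rfl⟩
  have : Nonempty C(S, PuncturedPlane) := ⟨.const _ ⟨1, one_ne_zero⟩⟩
  choose! F hF using fun (e : PuncturedPlane) (he : f e = φ a) => (hlift ⟨a, ha⟩ e he).exists
  have hFf : ∀ e : PuncturedPlane, f e = φ a → ∀ s : S, f (F e s) = φ s := fun e he s =>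
    congrFun (hF e he).2 s
  refine ⟨fun e s => if h : e ≠ 0 ∧ s ∈ S then F ⟨e, h.1⟩ ⟨s, h.2⟩ else 0, ?_, ?_⟩
  · rintro e ⟨he0, he⟩
    set σ : ℂ → ℂ := fun s => if h : e ≠ 0 ∧ s ∈ S then F ⟨e, h.1⟩ ⟨s, h.2⟩ else 0
    have hσ : ∀ s (hs : s ∈ S), σ s = F ⟨e, he0⟩ ⟨s, hs⟩ := fun s hs => dif_pos ⟨he0, hs⟩
    have hσc : ContinuousOn σ S := by
      rw [continuousOn_iff_continuous_domRestrict]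
      exact (continuous_subtype_val.comp (F ⟨e, he0⟩).continuous).congr fun s => (hσ s s.2).symm
    have hσf : ∀ s ∈ S, f (σ s) = φ s := fun s hs => by
      rw [hσ s hs]; exact hFf ⟨e, he0⟩ he ⟨s, hs⟩
    have hσ0 : ∀ s ∈ S, σ s ≠ 0 := fun s hs => by
      rw [hσ s hs]; exact (F ⟨e, he0⟩ ⟨s, hs⟩).2
    intro s hs
    have hnh := hSo.mem_nhds hs
    exact ((hf.analyticAt (isOpen_punctured.mem_nhds (hσ0 s hs))).hasStrictDerivAt.differentiableAt_lift
      (hreg s hs _ ⟨hσ0 s hs, hσf s hs⟩) (hσc.continuousAt hnh) (hφ.differentiableAt hnh)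
      (eventually_of_mem hnh hσf)).differentiableWithinAt
  · intro s hs
    refine ⟨?_, ?_, ?_⟩
    · rintro e ⟨he0, he⟩
      simp only [dif_pos (show e ≠ 0 ∧ s ∈ S from ⟨he0, hs⟩)]
      exact ⟨(F ⟨e, he0⟩ ⟨s, hs⟩).2, hFf ⟨e, he0⟩ he ⟨s, hs⟩⟩
    · rintro e ⟨he0, he⟩ e' ⟨he0', he'⟩ heq
      simp only [dif_pos (show e ≠ 0 ∧ s ∈ S from ⟨he0, hs⟩),
        dif_pos (show e' ≠ 0 ∧ s ∈ S from ⟨he0', hs⟩)] at heq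
      have heq' := Subtype.ext heq
      have := (hlift ⟨s, hs⟩ _ (hFf ⟨e, he0⟩ he ⟨s, hs⟩)).unique ⟨rfl, (hF ⟨e, he0⟩ he).2⟩
        ⟨heq'.symm, (hF ⟨e', he0'⟩ he').2⟩
      have h1 := (hF ⟨e, he0⟩ he).1
      rw [this, (hF ⟨e', he0'⟩ he').1] at h1
      exact (congrArg Subtype.val h1).symm
    · rintro z ⟨hz0, hz⟩
      obtain ⟨G, hG, hGf⟩ := (hlift ⟨s, hs⟩ ⟨z, hz0⟩ hz).exists
      have hGa : f (G ⟨a, ha⟩) = φ a := congrFun hGf ⟨a, ha⟩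
      have := (hlift ⟨a, ha⟩ (G ⟨a, ha⟩) hGa).unique (hF _ hGa) ⟨rfl, hGf⟩
      refine ⟨G ⟨a, ha⟩, ⟨(G ⟨a, ha⟩).2, hGa⟩, ?_⟩
      simp only [dif_pos (show (G ⟨a, ha⟩ : ℂ) ≠ 0 ∧ s ∈ S from ⟨(G ⟨a, ha⟩).2, hs⟩)]
      rw [Subtype.coe_eta, this, hG]

/-- A proper holomorphic map from the punctured plane to the plane without critical points
is injective. -/
theorem injective_of_isProperMap_of_deriv_ne_zero {f : ℂ → ℂ}
    (hf : DifferentiableOn ℂ f {z | z ≠ 0}) (hp : IsProperMap (fun z : PuncturedPlane => f z))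
    (hreg : ∀ z, z ≠ 0 → deriv f z ≠ 0) :
    Function.Injective (fun z : PuncturedPlane => f z) := by
  have hcov : IsCoveringMap (fun z : PuncturedPlane => f z) :=
    isCoveringMap_iff_isCoveringMapOn_univ.2
      (isCoveringMapOn_of_isProperMap hf hp fun t _ z hz => hreg z hz.1)
  have : PreconnectedSpace PuncturedPlane :=
    Subtype.preconnectedSpace ((isConnected_compl_singleton_of_one_lt_rank (by simp) (0 : ℂ)).isPreconnected)
  intro x y hxy
  -- The plane is simply connected, so its identity lifts to a section `s` through `x`. Both `s ∘ f`
  -- and `id` lift `f` and agree at `x`, so they coincide on the connected punctured plane.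
  obtain ⟨s, hsx, hs⟩ := (hcov.existsUnique_continuousMap_lifts (.id ℂ) (f x) x rfl).exists
  have hsec : s ∘ (fun z : PuncturedPlane => f z) = id :=
    hcov.eq_of_comp_eq (s.continuous.comp hcov.continuous) continuous_id
      (by rw [← Function.comp_assoc, hs]; rfl) x hsx
  exact Function.LeftInverse.injective (g := s) (congrFun hsec) hxy

/-! ### Properness of `(f, e^g)` near the punctures -/

/-- Preimages of compact sets under a proper map avoid neighbourhoods of `0` and of `∞`. -/
theorem IsProperMap.eventually_notMem {X : Type*} [TopologicalSpace X] {F : PuncturedPlane → X}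
    (hF : IsProperMap F) {K : Set X} (hK : IsCompact K) :
    (∀ᶠ z in 𝓝[≠] (0 : ℂ), ∀ h : z ≠ 0, F ⟨z, h⟩ ∉ K) ∧
      ∀ᶠ w in 𝓝[≠] (0 : ℂ), ∀ h : w⁻¹ ≠ 0, F ⟨w⁻¹, h⟩ ∉ K := by
  have hc := (hF.isCompact_preimage hK).image continuous_subtype_val
  have h0 : (0 : ℂ) ∉ Subtype.val '' (F ⁻¹' K) := by
    rintro ⟨z, -, hz⟩
    exact z.2 hz
  constructor
  · filter_upwards [nhdsWithin_le_nhds (hc.isClosed.isOpen_compl.mem_nhds h0)] with z hz h hzK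
    exact hz ⟨_, hzK, rfl⟩
  · have h1 : (Subtype.val '' (F ⁻¹' K))ᶜ ∈ Bornology.cobounded ℂ := hc.isBounded
    filter_upwards [tendsto_inv₀_nhdsNE_zero h1] with w hw h hwK
    exact hw ⟨_, hwK, rfl⟩

theorem isCompact_punctured_annulus (r R : ℝ) (hr : 0 < r) :
    IsCompact {z : PuncturedPlane | r ≤ ‖(z : ℂ)‖ ∧ ‖(z : ℂ)‖ ≤ R} := by
  rw [Subtype.isCompact_iff]
  have : Subtype.val '' {z : PuncturedPlane | r ≤ ‖(z : ℂ)‖ ∧ ‖(z : ℂ)‖ ≤ R} =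
      Metric.closedBall 0 R ∩ {z | r ≤ ‖z‖} := by
    ext z
    constructor
    · rintro ⟨w, hw, rfl⟩
      exact ⟨by simpa using hw.2, hw.1⟩
    · rintro ⟨h1, h2⟩
      exact ⟨⟨z, norm_pos_iff.1 (hr.trans_le h2)⟩, ⟨h2, by simpa using h1⟩, rfl⟩
  rw [this]
  exact (isCompact_closedBall 0 R).inter_right (isClosed_le continuous_const continuous_norm)

/-- Where `f` is bounded, properness of `(f, e^g)` forces `|Re g|` to be large near the
punctures. -/
theorem eventually_lt_abs_re_of_isProperMap {f g : ℂ → ℂ} (hp : IsProperMap (pairExpMap f g))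
    (M : ℝ) :
    (∀ᶠ z in 𝓝[≠] (0 : ℂ), ‖f z‖ ≤ M → M < |(g z).re|) ∧
      ∀ᶠ w in 𝓝[≠] (0 : ℂ), ‖f w⁻¹‖ ≤ M → M < |(g w⁻¹).re| := by
  have hK := (isCompact_closedBall (0 : ℂ) M).prod
    (isCompact_punctured_annulus (Real.exp (-M)) (Real.exp M) (Real.exp_pos _))
  have key : ∀ z (h : z ≠ 0), pairExpMap f g ⟨z, h⟩ ∉ Metric.closedBall (0 : ℂ) M ×ˢ
      {z : PuncturedPlane | Real.exp (-M) ≤ ‖(z : ℂ)‖ ∧ ‖(z : ℂ)‖ ≤ Real.exp M} →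
      ‖f z‖ ≤ M → M < |(g z).re| := by
    intro z h hz hfz
    by_contra! hle
    refine hz ⟨by simpa [pairExpMap] using hfz, ?_⟩
    simpa [pairExpMap, Complex.norm_exp] using abs_le.1 hle
  obtain ⟨h1, h2⟩ := hp.eventually_notMem hK
  constructor
  · filter_upwards [h1, eventually_mem_nhdsWithin] with z hz h0
    exact key z h0 (hz h0)
  · filter_upwards [h2, eventually_mem_nhdsWithin] with z hz h0
    exact key _ (inv_ne_zero h0) (hz (inv_ne_zero h0))

/-- A function that is bounded near a puncture cannot be the first component of a proper map
`(f, e^g)`. -/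
theorem not_hasRemovableSingularityAt {f g : ℂ → ℂ} {a : ℂ} (hg : HasIsolatedSingularityAt g a)
    (h : ∀ M : ℝ, ∀ᶠ z in 𝓝[≠] a, ‖f z‖ ≤ M → M < |(g z).re|) :
    ¬ HasRemovableSingularityAt f a := by
  rintro ⟨k, hk, hfk⟩
  have hb : ∀ᶠ z in 𝓝[≠] a, ‖f z‖ ≤ ‖k a‖ + 1 := by
    filter_upwards [hfk, nhdsWithin_le_nhds (hk.continuousAt.norm.eventually_lt_const
      (lt_add_one ‖k a‖))] with z h1 h2
    rw [h1]; exact h2.le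
  have hre : Tendsto (fun z => |(g z).re|) (𝓝[≠] a) atTop := by
    refine tendsto_atTop.2 fun M => ?_
    filter_upwards [hb, h (max M (‖k a‖ + 1))] with z h1 h2
    exact (le_max_left _ _).trans (h2 (h1.trans (le_max_right _ _))).le
  have hpole : HasPoleAt g a :=
    ⟨hg, tendsto_atTop_mono (fun z => Complex.abs_re_le_norm _) hre⟩
  -- All large values are taken where `Re g ≠ 0`, yet some of them are purely imaginary.
  have hbig : ∀ᶠ t in Bornology.cobounded ℂ, 0 < |t.re| :=
    hpole.cobounded_le_map (hre.eventually_gt_atTop 0)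
  have hI : Tendsto (fun x : ℝ => (x : ℂ) * Complex.I) atTop (Bornology.cobounded ℂ) := by
    rw [← tendsto_norm_atTop_iff_cobounded]
    simpa using tendsto_abs_atTop_atTop
  obtain ⟨x, hx⟩ := (hI.eventually hbig).exists
  simp at hx

theorem hasPoleAt_of_not_hasEssentialSingularityAt {f g : ℂ → ℂ} {a : ℂ}
    (hf : HasIsolatedSingularityAt f a) (hg : HasIsolatedSingularityAt g a)
    (h : ∀ M : ℝ, ∀ᶠ z in 𝓝[≠] a, ‖f z‖ ≤ M → M < |(g z).re|)
    (hess : ¬ HasEssentialSingularityAt f a) : HasPoleAt f a := by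
  by_contra hpole
  exact hess ⟨hf, not_hasRemovableSingularityAt hg h, hpole⟩

theorem hasIsolatedSingularityAt_zero {f : ℂ → ℂ} (hf : DifferentiableOn ℂ f {z | z ≠ 0}) :
    HasIsolatedSingularityAt f 0 := by
  filter_upwards [eventually_mem_nhdsWithin] with z hz
  exact hf.differentiableAt (isOpen_punctured.mem_nhds hz)

theorem differentiableOn_comp_inv {f : ℂ → ℂ} (hf : DifferentiableOn ℂ f {z | z ≠ 0}) :
    DifferentiableOn ℂ (fun w => f w⁻¹) {z | z ≠ 0} :=
  hf.comp differentiableOn_inv fun _ hz => inv_ne_zero hz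

/-! ### Functions with poles at both punctures -/

/-- The set where a condition holding near both punctures fails lies in an annulus. -/
theorem exists_annulus_of_eventually {p : ℂ → Prop} (h0 : ∀ᶠ z in 𝓝[≠] (0 : ℂ), p z)
    (hinf : ∀ᶠ w in 𝓝[≠] (0 : ℂ), p w⁻¹) :
    ∃ r R : ℝ, 0 < r ∧ ∀ z, z ≠ 0 → ¬ p z → r ≤ ‖z‖ ∧ ‖z‖ ≤ R := by
  obtain ⟨r, hr, h1⟩ := Metric.eventually_nhds_iff_ball.1 (eventually_nhdsWithin_iff.1 h0)
  obtain ⟨s, hs, h2⟩ := Metric.eventually_nhds_iff_ball.1 (eventually_nhdsWithin_iff.1 hinf)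
  refine ⟨r, s⁻¹, hr, fun z hz hpz => ⟨?_, ?_⟩⟩
  · by_contra! hlt
    exact hpz (h1 z (by simpa using hlt) hz)
  · by_contra! hlt
    refine hpz (inv_inv z ▸ h2 z⁻¹ ?_ (inv_ne_zero hz))
    simpa using inv_lt_of_inv_lt₀ hs hlt

/-- A holomorphic function with poles at both punctures is proper. -/
theorem isProperMap_of_hasPoleAt {f : ℂ → ℂ} (hf : DifferentiableOn ℂ f {z | z ≠ 0})
    (h0 : HasPoleAt f 0) (hinf : HasPoleAt (fun w => f w⁻¹) 0) :
    IsProperMap (fun z : PuncturedPlane => f z) := by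
  have hcont : Continuous (fun z : PuncturedPlane => f z) := hf.continuousOn.domRestrict
  refine isProperMap_iff_isCompact_preimage.2 ⟨hcont, fun K hK => ?_⟩
  obtain ⟨M, hM⟩ := hK.isBounded.exists_norm_le
  obtain ⟨r, R, hr, h⟩ := exists_annulus_of_eventually (p := fun z => M < ‖f z‖)
    (h0.2.eventually_gt_atTop M) (hinf.2.eventually_gt_atTop M)
  exact (isCompact_punctured_annulus r R hr).of_isClosed_subset (hK.isClosed.preimage hcont)
    fun z hz => h z z.2 (not_lt.2 (hM _ hz))

/-- Critical points avoid both poles, so they lie in a compact annulus. Infinitely many would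
accumulate there, and the identity theorem would give `deriv f = 0` everywhere. -/
theorem finite_critical_of_hasPoleAt {f : ℂ → ℂ} (hf : DifferentiableOn ℂ f {z | z ≠ 0})
    (h0 : HasPoleAt f 0) (hinf : HasPoleAt (fun w => f w⁻¹) 0) :
    {z | z ≠ 0 ∧ deriv f z = 0}.Finite := by
  have hdinf : ∀ᶠ w in 𝓝[≠] (0 : ℂ), deriv f w⁻¹ ≠ 0 := by
    filter_upwards [hinf.eventually_deriv_ne_zero, eventually_mem_nhdsWithin] with w hw hw0 h
    have h1 := (hf.differentiableAt (isOpen_punctured.mem_nhds (inv_ne_zero hw0))).hasDerivAt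
    have h2 := h1.comp w (hasDerivAt_inv hw0)
    rw [h, zero_mul] at h2
    exact hw h2.deriv
  obtain ⟨r, R, hr, h⟩ := exists_annulus_of_eventually (p := fun z => deriv f z ≠ 0)
    h0.eventually_deriv_ne_zero hdinf
  have hK := (isCompact_punctured_annulus r R hr).image continuous_subtype_val
  by_contra hnf
  obtain ⟨x, hx, hacc⟩ := Set.Infinite.exists_accPt_of_subset_isCompact hnf hK fun z hz =>
    ⟨⟨z, hz.1⟩, h z hz.1 (not_not.2 hz.2), rfl⟩
  obtain ⟨x, -, rfl⟩ := hx
  have hfreq : ∃ᶠ z in 𝓝[≠] (x : ℂ), deriv f z = 0 :=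
    (accPt_iff_frequently_nhdsNE.1 hacc).mono fun z hz => hz.2
  have hzero := ((hf.deriv isOpen_punctured).analyticOnNhd
    isOpen_punctured).eqOn_zero_of_preconnected_of_frequently_eq_zero
    (isConnected_compl_singleton_of_one_lt_rank (by simp) (0 : ℂ)).isPreconnected x.2 hfreq
  obtain ⟨z, hz, hz0⟩ := (h0.eventually_deriv_ne_zero.and eventually_mem_nhdsWithin).exists
  exact hz (hzero hz0)

/-- A holomorphic function with poles at both punctures has a critical point: otherwise it would be
injective, but it takes every large value near each puncture. -/
theorem exists_critical_of_hasPoleAt {f : ℂ → ℂ} (hf : DifferentiableOn ℂ f {z | z ≠ 0})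
    (h0 : HasPoleAt f 0) (hinf : HasPoleAt (fun w => f w⁻¹) 0) :
    ∃ z, z ≠ 0 ∧ deriv f z = 0 := by
  by_contra! hreg
  have hinj := injective_of_isProperMap_of_deriv_ne_zero hf (isProperMap_of_hasPoleAt hf h0 hinf)
    hreg
  have hsmall : {z : ℂ | ‖z‖ < 1 ∧ z ≠ 0} ∈ 𝓝[≠] (0 : ℂ) := by
    filter_upwards [nhdsWithin_le_nhds (Metric.ball_mem_nhds (0 : ℂ) one_pos),
      eventually_mem_nhdsWithin] with z h1 h2 using ⟨by simpa using h1, h2⟩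
  obtain ⟨t, ⟨z, ⟨hz, hz0⟩, hzt⟩, ⟨w, ⟨hw, hw0⟩, hwt⟩⟩ :=
    ((show ∀ᶠ t in Bornology.cobounded ℂ, t ∈ f '' _ from
      h0.cobounded_le_map (image_mem_map hsmall)).and
    (show ∀ᶠ t in Bornology.cobounded ℂ, t ∈ (fun w => f w⁻¹) '' _ from
      hinf.cobounded_le_map (image_mem_map hsmall))).exists
  have := congrArg Subtype.val
    (@hinj ⟨z, hz0⟩ ⟨w⁻¹, inv_ne_zero hw0⟩ (hzt.trans hwt.symm))
  simp only at this
  rw [this, norm_inv] at hz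
  exact absurd hz (not_lt.2 (one_le_inv_iff₀.2 ⟨norm_pos_iff.2 hw0, hw.le⟩))

/-! ### The fibre discriminant -/

/-- The product of the differences of the values of `g` over all ordered pairs of distinct points
in the fibre of `f` over `t`. -/
noncomputable def fiberDiscr (f g : ℂ → ℂ) (t : ℂ) : ℂ :=
  ∏ᶠ p ∈ (puncturedFiber f t).offDiag, (g p.1 - g p.2)

/-- Over a convex set of parameters with regular values, the fibre discriminant is a finite product
of holomorphic functions, which enumerate the differences of `g` over the fibres. -/
theorem exists_fiberDiscr_eq_prod {f g : ℂ → ℂ} (hf : DifferentiableOn ℂ f {z | z ≠ 0})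
    (hg : DifferentiableOn ℂ g {z | z ≠ 0})
    (hp : IsProperMap (fun z : PuncturedPlane => f z)) {S : Set ℂ} (hSc : Convex ℝ S)
    (hSo : IsOpen S) (hSn : S.Nonempty) {φ : ℂ → ℂ} (hφ : DifferentiableOn ℂ φ S)
    (hreg : ∀ s ∈ S, ∀ z ∈ puncturedFiber f (φ s), deriv f z ≠ 0) :
    ∃ (T : Finset (ℂ × ℂ)) (h : ℂ × ℂ → ℂ → ℂ), (∀ p ∈ T, DifferentiableOn ℂ (h p) S) ∧
      ∀ s ∈ S, fiberDiscr f g (φ s) = ∏ p ∈ T, h p s ∧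
        (∀ p ∈ T, ∃ q ∈ (puncturedFiber f (φ s)).offDiag, h p s = g q.1 - g q.2) ∧
        ∀ q ∈ (puncturedFiber f (φ s)).offDiag, ∃ p ∈ T, h p s = g q.1 - g q.2 := by
  obtain ⟨a, ha⟩ := hSn
  obtain ⟨σ, hσd, hσ⟩ := exists_sections_of_isProperMap hf hp hSc hSo hφ hreg ha
  have hfin : (puncturedFiber f (φ a)).offDiag.Finite :=
    (finite_puncturedFiber hf hp (hreg a ha)).offDiag
  have hbij : ∀ s ∈ S, Set.BijOn (fun p : ℂ × ℂ => (σ p.1 s, σ p.2 s))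
      (puncturedFiber f (φ a)).offDiag (puncturedFiber f (φ s)).offDiag := by
    intro s hs
    obtain ⟨hm, hi, hsu⟩ := hσ s hs
    refine ⟨fun p ⟨h1, h2, h3⟩ => ⟨hm h1, hm h2, fun h => h3 (hi h1 h2 h)⟩, ?_, ?_⟩
    · rintro p ⟨h1, h2, -⟩ q ⟨h1', h2', -⟩ h
      exact Prod.ext (hi h1 h1' (congrArg Prod.fst h)) (hi h2 h2' (congrArg Prod.snd h))
    · rintro ⟨x, y⟩ ⟨h1, h2, h3⟩
      obtain ⟨e, he, rfl⟩ := hsu h1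
      obtain ⟨e', he', rfl⟩ := hsu h2
      exact ⟨(e, e'), ⟨he, he', fun h => h3 (by simp only at h; rw [h])⟩, rfl⟩
  refine ⟨hfin.toFinset, fun p s => g (σ p.1 s) - g (σ p.2 s), fun p hpT => ?_, fun s hs =>
    ⟨?_, fun p hpT => ?_, fun q hq => ?_⟩⟩
  · have hpT' := (Set.Finite.mem_toFinset _).1 hpT
    have h : ∀ e ∈ puncturedFiber f (φ a), DifferentiableOn ℂ (fun s => g (σ e s)) S := fun e he =>
      hg.comp (hσd e he) fun s hs => ((hσ s hs).mapsTo he).1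
    exact (h _ hpT'.1).sub (h _ hpT'.2.1)
  · rw [fiberDiscr, ← finprod_mem_eq_finite_toFinset_prod]
    exact (finprod_mem_eq_of_bijOn _ (hbij s hs) fun p _ => rfl).symm
  · exact ⟨_, (hbij s hs).mapsTo ((Set.Finite.mem_toFinset _).1 hpT), rfl⟩
  · obtain ⟨p, hpT, rfl⟩ := (hbij s hs).surjOn hq
    exact ⟨p, (Set.Finite.mem_toFinset _).2 hpT, rfl⟩

theorem differentiableAt_fiberDiscr {f g : ℂ → ℂ} (hf : DifferentiableOn ℂ f {z | z ≠ 0})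
    (hg : DifferentiableOn ℂ g {z | z ≠ 0}) (hp : IsProperMap (fun z : PuncturedPlane => f z))
    {t : ℂ} (hreg : ∀ᶠ s in 𝓝 t, ∀ z ∈ puncturedFiber f s, deriv f z ≠ 0) :
    DifferentiableAt ℂ (fiberDiscr f g) t := by
  obtain ⟨r, hr, hball⟩ := Metric.eventually_nhds_iff_ball.1 hreg
  obtain ⟨T, h, hd, hT⟩ := exists_fiberDiscr_eq_prod (φ := id) hf hg hp (convex_ball t r)
    Metric.isOpen_ball ⟨t, Metric.mem_ball_self hr⟩ differentiableOn_id hball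
  have hnh := Metric.ball_mem_nhds t hr
  refine DifferentiableAt.congr_of_eventuallyEq (f := fun s => ∏ p ∈ T, h p s) ?_
    (eventually_of_mem hnh fun s hs => (hT s hs).1)
  exact DifferentiableAt.fun_finsetProd fun p hpT => (hd p hpT).differentiableAt hnh

theorem fiberDiscr_ne_zero {f g : ℂ → ℂ} (hf : DifferentiableOn ℂ f {z | z ≠ 0})
    (hp : IsProperMap (fun z : PuncturedPlane => f z)) {t : ℂ}
    (hreg : ∀ z ∈ puncturedFiber f t, deriv f z ≠ 0)
    (hinj : Set.InjOn g (puncturedFiber f t)) : fiberDiscr f g t ≠ 0 := by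
  rw [fiberDiscr, finprod_mem_eq_finite_toFinset_prod _ (finite_puncturedFiber hf hp hreg).offDiag]
  refine Finset.prod_ne_zero_iff.2 fun p hpT => sub_ne_zero.2 fun h => ?_
  obtain ⟨h1, h2, h3⟩ := (Set.Finite.mem_toFinset _).1 hpT
  exact h3 (hinj h1 h2 h)

/-- Near any value, the fibre discriminant is bounded, and it is small if `g` nearly coincides
at two points of the fibre. -/
theorem exists_norm_fiberDiscr_le {f g : ℂ → ℂ} (hf : DifferentiableOn ℂ f {z | z ≠ 0})
    (hg : DifferentiableOn ℂ g {z | z ≠ 0}) (hp : IsProperMap (fun z : PuncturedPlane => f z))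
    {b : ℂ} (hreg : ∀ᶠ s in 𝓝[≠] b, ∀ z ∈ puncturedFiber f s, deriv f z ≠ 0) :
    ∃ C, ∀ᶠ t in 𝓝[≠] b, ‖fiberDiscr f g t‖ ≤ C ∧
      ∀ q ∈ (puncturedFiber f t).offDiag, ‖fiberDiscr f g t‖ ≤ C * ‖g q.1 - g q.2‖ := by
  obtain ⟨r, hr, hball⟩ := Metric.eventually_nhds_iff_ball.1 (eventually_nhdsWithin_iff.1 hreg)
  have hK := hp.isCompact_preimage (isCompact_closedBall b r)
  obtain ⟨M, hM⟩ := hK.exists_bound_of_continuousOn (f := fun z : PuncturedPlane => g z)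
    hg.continuousOn.domRestrict.continuousOn
  have hS : {ξ : ℂ | ξ.re < Real.log r} = Complex.re ⁻¹' Set.Iio (Real.log r) := rfl
  have hmem : ∀ ξ : ℂ, ξ.re < Real.log r → b + Complex.exp ξ ∈ Metric.ball b r := fun ξ hξ => by
    rw [Metric.mem_ball, dist_eq_norm, add_sub_cancel_left, Complex.norm_exp]
    exact (Real.lt_log_iff_exp_lt hr).1 hξ
  -- The punctured disc is not simply connected, so it is parametrised by `b + exp ξ` on a
  -- half-plane, which is convex.
  obtain ⟨T, h, -, hT⟩ := exists_fiberDiscr_eq_prod (S := {ξ : ℂ | ξ.re < Real.log r})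
    (φ := fun ξ => b + Complex.exp ξ) hf hg hp
    (convex_halfSpace_re_lt _) (isOpen_lt Complex.continuous_re continuous_const)
    ⟨(Real.log r - 1 : ℝ), by simp only [Set.mem_ofPred_eq, Complex.ofReal_re]; linarith⟩
    (by fun_prop) (fun ξ hξ => hball _ (hmem ξ hξ) (by simp))
  -- The bound `1 ≤ A` lets `A ^ T.card` also dominate the product with one factor removed.
  set A := max 1 (2 * M) with hA
  have hA1 : 1 ≤ A := le_max_left _ _
  refine ⟨A ^ T.card, ?_⟩
  filter_upwards [nhdsWithin_le_nhds (Metric.ball_mem_nhds b hr), eventually_mem_nhdsWithin]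
    with t ht htb
  have htb' : t - b ≠ 0 := sub_ne_zero.2 htb
  have hlog : (Complex.log (t - b)).re < Real.log r := by
    rw [Complex.log_re]
    exact Real.log_lt_log (norm_pos_iff.2 htb') (by simpa [dist_eq_norm] using ht)
  have hte : b + Complex.exp (Complex.log (t - b)) = t := by rw [Complex.exp_log htb']; ring
  obtain ⟨h1, h2, h3⟩ := hT _ hlog
  simp only [hte] at h1 h2 h3
  have hle : ∀ p ∈ T, ‖h p (Complex.log (t - b))‖ ≤ A := fun p hpT => by
    obtain ⟨q, ⟨⟨hq1, hq1'⟩, ⟨hq2, hq2'⟩, -⟩, hq⟩ := h2 p hpT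
    have hM1 : ∀ z (hz : z ≠ 0), f z = t → ‖g z‖ ≤ M := fun z hz hzt =>
      hM ⟨z, hz⟩ (by simpa [hzt] using ht.le)
    rw [hq]
    refine (norm_sub_le _ _).trans (le_trans ?_ (le_max_right _ _))
    linarith [hM1 _ hq1 hq1', hM1 _ hq2 hq2']
  rw [h1]
  constructor
  · rw [norm_prod]
    exact (Finset.prod_le_prod (fun _ _ => norm_nonneg _) hle).trans_eq (by simp)
  · intro q hq
    obtain ⟨p, hpT, hpq⟩ := h3 q hq
    rw [← hpq, ← Finset.prod_erase_mul _ _ hpT, norm_mul, norm_prod]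
    gcongr
    refine (Finset.prod_le_prod (fun _ _ => norm_nonneg _)
      fun p hpT => hle p (Finset.mem_of_mem_erase hpT)).trans ?_
    rw [Finset.prod_const]
    exact pow_le_pow_right₀ hA1 (Finset.card_le_card (Finset.erase_subset _ _))

/-- If differences of `g` along the fibres of `f` omit `2πiℤ`, then the fibre discriminant grows
sublinearly. -/
theorem isLittleO_fiberDiscr {f g : ℂ → ℂ} (hf : DifferentiableOn ℂ f {z | z ≠ 0})
    (hg : DifferentiableOn ℂ g {z | z ≠ 0}) (hp : IsProperMap (fun z : PuncturedPlane => f z))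
    (hreg : ∀ᶠ s in Bornology.cobounded ℂ, ∀ z ∈ puncturedFiber f s, deriv f z ≠ 0)
    (hsep : ∀ t, ∀ q ∈ (puncturedFiber f t).offDiag, ∀ n : ℤ,
      g q.1 - g q.2 ≠ n * (2 * Real.pi * Complex.I)) :
    fiberDiscr f g =o[Bornology.cobounded ℂ] (fun t => t) := by
  rw [← comap_norm_atTop, eventually_comap] at hreg
  obtain ⟨N, hN⟩ := eventually_atTop.1 hreg
  -- The `1` ensures `0 ≤ R`, so that powers of `ξ.re - R` are bounded by powers of `ξ.re`.
  set R := Real.log (max N 1) with hR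
  have hR0 : 0 ≤ R := Real.log_nonneg (le_max_right _ _)
  have hS : ∀ ξ : ℂ, R < ξ.re → N ≤ ‖Complex.exp ξ‖ := fun ξ hξ => by
    rw [Complex.norm_exp]
    exact (le_max_left _ _).trans ((Real.log_lt_iff_lt_exp (by positivity)).1 hξ).le
  obtain ⟨T, h, hd, hT⟩ := exists_fiberDiscr_eq_prod (S := {ξ : ℂ | R < ξ.re})
    (φ := Complex.exp) hf hg hp
    (convex_halfSpace_re_gt _) (isOpen_lt continuous_const Complex.continuous_re)
    ⟨(R + 1 : ℝ), by simp⟩ (by fun_prop) (fun ξ hξ => hN _ (hS ξ hξ) _ rfl)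
  have h2pi : (2 * Real.pi * Complex.I : ℂ) ≠ 0 := Complex.two_pi_I_ne_zero
  -- The strip `|Im ξ| ≤ π` suffices, since each large `t` is reached through its principal
  -- logarithm.
  have hbound : ∀ p ∈ T, ∃ (C : ℝ) (k : ℕ), ∀ ξ : ℂ, R + 1 ≤ ξ.re → |ξ.im| ≤ Real.pi →
      ‖h p ξ‖ ≤ C * ξ.re ^ k := by
    intro p hpT
    obtain ⟨C, k, hC⟩ := exists_norm_le_pow_of_forall_ne_intCast (R := R)
      (F := fun ξ => h p ξ / (2 * Real.pi * Complex.I)) ((hd p hpT).div_const _) (by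
        intro ξ hξ n hn
        obtain ⟨q, hq, hpq⟩ := (hT ξ hξ).2.1 p hpT
        exact hsep _ q hq n (by rw [← hpq, ← hn, div_mul_cancel₀ _ h2pi]))
    refine ⟨|C| * ‖(2 * Real.pi * Complex.I : ℂ)‖, k, fun ξ h1 h2 => ?_⟩
    have h3 := hC ξ h1 h2
    rw [norm_div, div_le_iff₀ (norm_pos_iff.2 h2pi)] at h3
    refine h3.trans ?_
    rw [mul_right_comm]
    have h4 : 0 ≤ ξ.re - R := by linarith
    gcongr
    · exact le_abs_self C
    · linarith
  choose! C k hCk using hbound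
  have hlog : (fun t : ℂ => (∏ p ∈ T, C p) * Real.log ‖t‖ ^ (∑ p ∈ T, k p))
      =o[Bornology.cobounded ℂ] (fun t => ‖t‖) :=
    ((Real.isLittleO_pow_log_id_atTop (n := ∑ p ∈ T, k p)).const_mul_left
      (∏ p ∈ T, C p)).comp_tendsto tendsto_norm_cobounded_atTop
  refine Asymptotics.IsLittleO.of_norm_right (Asymptotics.IsBigO.trans_isLittleO ?_ hlog)
  refine Asymptotics.IsBigO.of_bound 1 ?_
  filter_upwards [tendsto_norm_cobounded_atTop.eventually_ge_atTop (Real.exp (R + 1))] with t ht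
  have ht0 : 0 < ‖t‖ := (Real.exp_pos _).trans_le ht
  have hre : R + 1 ≤ (Complex.log t).re := by
    rw [Complex.log_re]; exact (Real.le_log_iff_exp_le ht0).2 ht
  have hTt := (hT (Complex.log t) (show R < _ by linarith)).1
  rw [Complex.exp_log (norm_pos_iff.1 ht0)] at hTt
  rw [hTt, one_mul, norm_prod, ← Complex.log_re, ← Finset.prod_pow_eq_pow_sum,
    ← Finset.prod_mul_distrib]
  exact (Finset.prod_le_prod (fun _ _ => norm_nonneg _) fun p hpT =>
    hCk p hpT _ hre (by rw [Complex.log_im]; exact Complex.abs_arg_le_pi t)).trans (Real.le_norm_self _)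

/-! ### Liouville's theorem and the contradiction -/

/-- A finite set is avoided by a punctured neighbourhood of any point. -/
theorem Set.Finite.eventually_punctured_notMem {B : Set ℂ} (hB : B.Finite) (t : ℂ) :
    ∀ᶠ s in 𝓝[≠] t, s ∉ B := by
  have h := (hB.subset (Set.sdiff_subset (t := {t}))).isClosed.isOpen_compl.mem_nhds
    (show t ∈ (B \ {t})ᶜ by simp)
  filter_upwards [nhdsWithin_le_nhds h, eventually_mem_nhdsWithin] with s h1 h2 h3
  exact h1 ⟨h3, h2⟩

/-- **Liouville's theorem** for a function with finitely many removable singularities and sublinear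
growth. -/
theorem exists_forall_notMem_eq_of_isLittleO {D : ℂ → ℂ} {B : Set ℂ} (hB : B.Finite)
    (hd : ∀ t ∉ B, DifferentiableAt ℂ D t)
    (hb : ∀ t, ∃ C, ∀ᶠ s in 𝓝[≠] t, ‖D s‖ ≤ C)
    (ho : D =o[Bornology.cobounded ℂ] (fun t => t)) : ∃ c, ∀ t ∉ B, D t = c := by
  set E : ℂ → ℂ := fun t => limUnder (𝓝[≠] t) D with hE
  have hED : ∀ t ∉ B, E t = D t := fun t ht =>
    ((hd t ht).continuousAt.tendsto.mono_left nhdsWithin_le_nhds).limUnder_eq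
  have hBt := hB.eventually_punctured_notMem
  have hEd : Differentiable ℂ E := by
    intro t
    obtain ⟨C, hC⟩ := hb t
    obtain ⟨r, hr, hball⟩ := Metric.eventually_nhds_iff_ball.1
      (eventually_nhdsWithin_iff.1 ((hBt t).and hC))
    have h1 := Complex.differentiableOn_update_limUnder_of_bddAbove (f := D) (c := t)
      (Metric.ball_mem_nhds t hr)
      (fun s hs => (hd s (hball s hs.1 hs.2).1).differentiableWithinAt)
      ⟨C, by rintro _ ⟨s, hs, rfl⟩; exact (hball s hs.1 hs.2).2⟩
    refine (h1.differentiableAt (Metric.ball_mem_nhds t hr)).congr_of_eventuallyEq ?_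
    filter_upwards [Metric.ball_mem_nhds t hr] with s hs
    by_cases hst : s = t
    · subst hst; simp [hE]
    · rw [Function.update_of_ne hst, hED s (hball s hs hst).1]
  have hEo : E =o[Bornology.cobounded ℂ] (fun t => t) := by
    refine ho.congr' ?_ EventuallyEq.rfl
    have : ∀ᶠ t in Bornology.cobounded ℂ, t ∉ B := hB.isBounded
    filter_upwards [this] with t ht using (hED t ht).symm
  -- The difference quotient is entire and tends to `0` at infinity by sublinear growth, so it
  -- vanishes.
  have hslope : dslope E 0 = Function.const ℂ 0 := by
    refine Differentiable.eq_const_of_tendsto_cocompact (fun t => ?_) ?_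
    · exact ((Complex.differentiableOn_dslope (s := Set.univ) univ_mem).2
        hEd.differentiableOn).differentiableAt univ_mem
    · rw [← Metric.cobounded_eq_cocompact]
      have h1 := (hEo.sub (Asymptotics.isLittleO_const_left.2
        (.inr tendsto_norm_cobounded_atTop) : (fun _ => E 0) =o[_] _)).tendsto_div_nhds_zero
      refine h1.congr' ?_
      filter_upwards [Bornology.eventually_ne_cobounded (0 : ℂ)] with t ht
      rw [dslope_of_ne _ ht, slope_def_field, sub_zero]
  refine ⟨E 0, fun t ht => ?_⟩
  rw [← hED t ht]
  have := sub_smul_dslope E 0 t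
  rw [hslope] at this
  simpa [sub_eq_zero] using this.symm

/-- The differences of `g` along the fibres of a holomorphic function with poles at both punctures
cannot omit `2πiℤ`. -/
theorem exists_sub_eq_of_hasPoleAt {f g : ℂ → ℂ} (hf : DifferentiableOn ℂ f {z | z ≠ 0})
    (hg : DifferentiableOn ℂ g {z | z ≠ 0}) (h0 : HasPoleAt f 0)
    (hinf : HasPoleAt (fun w => f w⁻¹) 0) :
    ∃ z w, z ≠ 0 ∧ w ≠ 0 ∧ z ≠ w ∧ f z = f w ∧
      ∃ n : ℤ, g z - g w = n * (2 * Real.pi * Complex.I) := by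
  by_contra! hcon
  have hsep : ∀ t, ∀ q ∈ (puncturedFiber f t).offDiag, ∀ n : ℤ,
      g q.1 - g q.2 ≠ n * (2 * Real.pi * Complex.I) := fun t q hq n =>
    hcon _ _ hq.1.1 hq.2.1.1 hq.2.2 (hq.1.2.trans hq.2.1.2.symm) n
  have hp := isProperMap_of_hasPoleAt hf h0 hinf
  have hcrit := finite_critical_of_hasPoleAt hf h0 hinf
  set B : Set ℂ := f '' {z | z ≠ 0 ∧ deriv f z = 0} with hB
  have hBfin : B.Finite := hcrit.image f
  have hreg : ∀ t ∉ B, ∀ z ∈ puncturedFiber f t, deriv f z ≠ 0 := fun t ht z hz hdz =>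
    ht ⟨z, ⟨hz.1, hdz⟩, hz.2⟩
  have hBt := hBfin.eventually_punctured_notMem
  have hbd := fun b => exists_norm_fiberDiscr_le (g := g) (b := b) hf hg hp ((hBt b).mono hreg)
  obtain ⟨c, hc⟩ := exists_forall_notMem_eq_of_isLittleO (D := fiberDiscr f g) hBfin
    (fun t ht => differentiableAt_fiberDiscr hf hg hp
      (eventually_of_mem (hBfin.isClosed.isOpen_compl.mem_nhds ht) hreg))
    (fun t => (hbd t).imp fun C hC => hC.mono fun s hs => hs.1)
    (isLittleO_fiberDiscr hf hg hp
      ((show ∀ᶠ t in Bornology.cobounded ℂ, t ∉ B from hBfin.isBounded).mono hreg) hsep)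
  have hc0 : c ≠ 0 := by
    obtain ⟨t, ht⟩ := (hBt 0).exists
    rw [← hc t ht]
    refine fiberDiscr_ne_zero hf hp (hreg t ht) fun z hz w hw hzw => ?_
    by_contra hne
    exact hsep t (z, w) ⟨hz, hw, hne⟩ 0 (by simp [hzw])
  obtain ⟨z₀, hz₀, hdz₀⟩ := exists_critical_of_hasPoleAt hf h0 hinf
  have hnh := isOpen_punctured.mem_nhds hz₀
  have hfan := hf.analyticAt hnh
  have hne : ∀ᶠ z in 𝓝[≠] z₀, f z ≠ f z₀ := by
    refine (hfan.eventually_eq_or_eventually_ne analyticAt_const).resolve_left fun h => ?_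
    refine infinite_of_mem_nhds z₀ (inter_mem hnh h.eventually_nhds) (hcrit.subset fun z hz => ?_)
    refine ⟨hz.1, ?_⟩
    rw [EventuallyEq.deriv_eq hz.2]; simp
  obtain ⟨C, hC⟩ := hbd (f z₀)
  -- Two such differences add up to less than `‖c‖ / (|C| + 1)`, so the bound `C * ‖g z - g w‖`
  -- falls below `‖c‖`.
  have hsmall : ∀ᶠ z in 𝓝 z₀, ‖g z - g z₀‖ < ‖c‖ / (2 * (|C| + 1)) := by
    have := (hg.differentiableAt hnh).continuousAt
    have h1 := (this.sub_const (g z₀)).norm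
    refine h1.eventually_lt_const ?_
    simp only [sub_self, norm_zero]
    have := norm_pos_iff.2 hc0
    positivity
  have hV := (((eventually_nhdsWithin_iff.1 hne).and hsmall).and
    (hfan.continuousAt.eventually (eventually_nhdsWithin_iff.1 (hC.and (hBt _))))).and hnh
  -- `f` is not injective near its critical point `z₀`, which yields distinct nearby `z`, `w` in one
  -- fibre.
  have hninj : ¬ Set.InjOn f _ := fun hinj => deriv_ne_zero_of_injOn hV hfan hinj hdz₀
  simp only [Set.InjOn, not_forall] at hninj
  obtain ⟨z, hz, w, hw, hzw, hzw'⟩ := hninj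
  -- Near `z₀` the value `f z₀` is taken only at `z₀`, so the common value of `z` and `w` is another
  -- one, hence regular.
  have hfz : f z ≠ f z₀ := fun h => by
    have h1 : z = z₀ := by_contra fun h' => hz.1.1.1 h' h
    have h2 : w = z₀ := by_contra fun h' => hw.1.1.1 h' (hzw ▸ h)
    exact hzw' (h1.trans h2.symm)
  obtain ⟨hCz, hBz⟩ := hz.1.2 hfz
  have h1 := hCz.2 (z, w) ⟨⟨hz.2, rfl⟩, ⟨hw.2, hzw.symm⟩, hzw'⟩
  rw [hc _ hBz] at h1
  have h2 : ‖g z - g w‖ < ‖c‖ / (|C| + 1) := by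
    have := norm_sub_le (g z - g z₀) (g w - g z₀)
    rw [sub_sub_sub_cancel_right] at this
    have h3 : ‖c‖ / (|C| + 1) = ‖c‖ / (2 * (|C| + 1)) + ‖c‖ / (2 * (|C| + 1)) := by
      field_simp; ring
    linarith [hz.1.1.2, hw.1.1.2]
  rw [lt_div_iff₀ (by positivity)] at h2
  have h3 : C * ‖g z - g w‖ ≤ |C| * ‖g z - g w‖ := by gcongr; exact le_abs_self C
  linarith [norm_nonneg (g z - g w)]

theorem corollaryc (f g : ℂ → ℂ)
    (hf : DifferentiableOn ℂ f {z : ℂ | z ≠ 0})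
    (hg : DifferentiableOn ℂ g {z : ℂ | z ≠ 0})
    (hproper : IsProperMap (pairExpMap f g))
    (hinj : Function.Injective (pairExpMap f g)) :
    HasEssentialSingularityAt f 0 ∨ HasEssentialSingularityAtInfty f := by
  by_contra! hess
  obtain ⟨z, w, hz, hw, hne, hfzw, n, hn⟩ := exists_sub_eq_of_hasPoleAt hf hg
    (hasPoleAt_of_not_hasEssentialSingularityAt (hasIsolatedSingularityAt_zero hf)
      (hasIsolatedSingularityAt_zero hg)
      (fun M => (eventually_lt_abs_re_of_isProperMap hproper M).1) hess.1)
    (hasPoleAt_of_not_hasEssentialSingularityAt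
      (hasIsolatedSingularityAt_zero (differentiableOn_comp_inv hf))
      (hasIsolatedSingularityAt_zero (differentiableOn_comp_inv hg))
      (fun M => (eventually_lt_abs_re_of_isProperMap hproper M).2) hess.2)
  have hexp : Complex.exp (g z) = Complex.exp (g w) :=
    Complex.exp_eq_exp_iff_exists_int.2 ⟨n, by linear_combination hn⟩
  have := @hinj ⟨z, hz⟩ ⟨w, hw⟩ (Prod.ext hfzw (Subtype.ext hexp))
  exact hne (congrArg Subtype.val this)
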